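/- For positive integers $k,\ell$ let $G_k(\ell)=\{g\in\mathbb{Z}_{\ge 1} : \gcd(g\ell,k)=g\}$ (a finite set). A permutation $\tau$ is called an even (respectively odd) $k$th root of a permutation $\sigma$ if $\tau^k=\sigma$ and $\tau$ is an even (respectively odd) permutation. A permutation of $\{1,\dots,n\}$ has cycle type $(c_1,\dots,c_n)$ if, for every $i\in\{1,\dots,n\}$, it has exactly $c_i$ cycles of length $i$ (fixed points being cycles of length $1$). Let $k,n$ be positive integers, let $c_1,\dots,c_n$ be non-negative integers with $n=c_1+2c_2+\cdots+nc_n$, and let $\sigma$ be a permutation of $\{1,\dots,n\}$ of cycle type $(c_1,\dots,c_n)$. Then, for formal power series in the variables $t_1,t_2,\dots$ with rational coefficients, the coefficient of $\frac{t_1^{c_1}\cdots t_n^{c_n}}{c_1!\cdots c_n!}$ in $$\frac12\exp\left(\sum_{\ell\ge1}\sum_{g\in G_k(\ell)}\frac{\ell^{g-1}}{g}t_\ell^g\right)+\frac12\exp\left(\sum_{\ell\ge1}\sum_{g\in G_k(\ell)}(-1)^{\ell g+1}\frac{\ell^{g-1}}{g}t_\ell^g\right)$$ is the number of even $k$th roots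 of $\sigma$, and the coefficient of $\frac{t_1^{c_1}\cdots t_n^{c_n}}{c_1!\cdots c_n!}$ in $$\frac12\exp\left(\sum_{\ell\ge1}\sum_{g\in G_k(\ell)}\frac{\ell^{g-1}}{g}t_\ell^g\right)-\frac12\exp\left(\sum_{\ell\ge1}\sum_{g\in G_k(\ell)}(-1)^{\ell g+1}\frac{\ell^{g-1}}{g}t_\ell^g\right)$$ is the number of odd $k$th roots of $\sigma$. -/

import Mathlib

noncomputable section

namespace PermRoots

/-- The set `G_k(ℓ) = {g ∈ ℕ : g ≥ 1, gcd(gℓ, k) = g}`. For `k ≥ 1` each such `g` divides `k`, so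
nothing is lost by restricting to `1 ≤ g ≤ k`; see `mem_G`. -/
def G (k ℓ : ℕ) : Finset ℕ :=
  (Finset.Icc 1 k).filter fun g => Nat.gcd (g * ℓ) k = g

theorem mem_G {k ℓ g : ℕ} (hk : 0 < k) : g ∈ G k ℓ ↔ 0 < g ∧ Nat.gcd (g * ℓ) k = g := by
  simp only [G, Finset.mem_filter, Finset.mem_Icc]
  constructor
  · rintro ⟨⟨h, -⟩, h'⟩
    exact ⟨h, h'⟩
  · rintro ⟨h, h'⟩
    exact ⟨⟨h, Nat.le_of_dvd hk (h' ▸ Nat.gcd_dvd_right _ _)⟩, h'⟩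

/-- Formal power series with rational coefficients in the variables `t₁, t₂, …`. -/
abbrev Series := MvPowerSeries ℕ+ ℚ

/-- The formal sum `∑_{ℓ ≥ 1} f ℓ` of a locally finite family of power series, i.e. one in which
each monomial occurs in only finitely many members. It is taken coefficient by coefficient. -/
def formalSum (f : ℕ+ → Series) : Series :=
  fun d => ∑ᶠ ℓ : ℕ+, MvPowerSeries.coeff d (f ℓ)

/-- `∑_{g ∈ G_k(ℓ)} (ℓ^(g-1) / g) t_ℓ^g`. -/
def term (k : ℕ) (ℓ : ℕ+) : Series :=
  ∑ g ∈ G k ℓ, (((ℓ : ℕ) : ℚ) ^ (g - 1) / (g : ℚ)) • (MvPowerSeries.X ℓ : Series) ^ g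

/-- `∑_{g ∈ G_k(ℓ)} (-1)^(ℓg+1) (ℓ^(g-1) / g) t_ℓ^g`. -/
def signedTerm (k : ℕ) (ℓ : ℕ+) : Series :=
  ∑ g ∈ G k ℓ, ((-1 : ℚ) ^ ((ℓ : ℕ) * g + 1) * (((ℓ : ℕ) : ℚ) ^ (g - 1) / (g : ℚ))) •
    (MvPowerSeries.X ℓ : Series) ^ g

/-- The formal exponential `exp(F) = ∑_m F^m / m!`, for `F` with zero constant term. -/
def expSeries (F : Series) : Series :=
  (PowerSeries.exp ℚ).subst F

/-- `½ exp(∑_ℓ ∑_g ℓ^(g-1) t_ℓ^g / g) + ½ exp(∑_ℓ ∑_g (-1)^(ℓg+1) ℓ^(g-1) t_ℓ^g / g)`. -/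
def evenSeries (k : ℕ) : Series :=
  (1 / 2 : ℚ) • expSeries (formalSum (term k)) + (1 / 2 : ℚ) • expSeries (formalSum (signedTerm k))

/-- `½ exp(∑_ℓ ∑_g ℓ^(g-1) t_ℓ^g / g) - ½ exp(∑_ℓ ∑_g (-1)^(ℓg+1) ℓ^(g-1) t_ℓ^g / g)`. -/
def oddSeries (k : ℕ) : Series :=
  (1 / 2 : ℚ) • expSeries (formalSum (term k)) - (1 / 2 : ℚ) • expSeries (formalSum (signedTerm k))

/-- The exponent vector of `t₁^{c₁} ⋯ t_n^{c_n}`, where `c i` stands for `c_{i+1}`. -/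
def exponent {n : ℕ} (c : Fin n → ℕ) : ℕ+ →₀ ℕ :=
  ∑ i : Fin n, Finsupp.single (Nat.succPNat i) (c i)

/-- The coefficient of `t₁^{c₁} ⋯ t_n^{c_n} / (c₁! ⋯ c_n!)` in `F`. -/
def egfCoeff {n : ℕ} (c : Fin n → ℕ) (F : Series) : ℚ :=
  (∏ i : Fin n, ((c i).factorial : ℚ)) * MvPowerSeries.coeff (exponent c) F

/-- `σ` has cycle type `(c₁, …, c_n)`: for `1 ≤ i ≤ n` it has exactly `c_i` cycles of length `i`,
fixed points being the cycles of length 1. Again `c i` stands for `c_{i+1}`. -/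
def HasCycleType {n : ℕ} (σ : Equiv.Perm (Fin n)) (c : Fin n → ℕ) : Prop :=
  ∀ i : Fin n, σ.partition.parts.count ((i : ℕ) + 1) = c i

/-- The number of even `k`th roots of `σ`. -/
def numEvenRoots {n : ℕ} (k : ℕ) (σ : Equiv.Perm (Fin n)) : ℕ :=
  Nat.card {τ : Equiv.Perm (Fin n) // τ ^ k = σ ∧ Equiv.Perm.sign τ = 1}

/-- The number of odd `k`th roots of `σ`. -/
def numOddRoots {n : ℕ} (k : ℕ) (σ : Equiv.Perm (Fin n)) : ℕ :=
  Nat.card {τ : Equiv.Perm (Fin n) // τ ^ k = σ ∧ Equiv.Perm.sign τ = -1}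

end PermRoots

end

open Equiv Equiv.Perm Finset

namespace PermRoots

/-! The `k`th power of an `m`-cycle consists of `g = gcd(m, k)` cycles of length `ℓ = m / g`, and
the pairs `(ℓ, g)` with `g ∈ G_k(ℓ)` correspond bijectively to the lengths `m = ℓg`. Giving each
`m`-cycle of a root the weight `s m`, the exponent becomes `∑_m s(m) (ℓ^g / m) t_ℓ^g`, because
`ℓ^(g-1) / g = ℓ^g / m`.

In its exponential the coefficient of `t^c` is a sum over vectors `j` (the root has `j_m` cycles of
length `m`) whose `k`th power has cycle type `c`. The factor `1 / ∏ m^(j_m) j_m!` is the proportion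
of permutations of type `j` (`card_cycleCount_eq`). The powers of `ℓ` combine to `∏ l^(c_l)`
(`prod_splitLength_pow`), which together with `∏ c_l!` is the order of the centralizer of `σ`. Hence
the normalized coefficient is the weighted number of `τ` with `τ ^ k` conjugate to `σ`, divided by
the size of the class of `σ`; by `sum_isConj_pow` this is the weighted number of roots of `σ` itself
(`egfCoeff_expSeries_weightedTerm`).

The weight `s = 1` counts all roots, and `s m = (-1)^(m+1)` sums their signs. Half the sum and half
the difference separate even from odd roots. -/

theorem prod_fin_succ {M : Type*} [CommMonoid M] (n : ℕ) (f : ℕ → M) :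
    ∏ i : Fin n, f ((i : ℕ) + 1) = ∏ m ∈ Icc 1 n, f m := by
  rw [Fin.prod_univ_eq_prod_range (fun i => f (i + 1)) n]
  refine Finset.prod_bij (fun i _ => i + 1) ?_ ?_ ?_ ?_
  · intro i hi; simp at hi ⊢; omega
  · intro i _ j _ h; omega
  · intro m hm; simp at hm; exact ⟨m - 1, by simp; omega, by omega⟩
  · intros; rfl

theorem sum_fin_succ {M : Type*} [AddCommMonoid M] (n : ℕ) (f : ℕ → M) :
    ∑ i : Fin n, f ((i : ℕ) + 1) = ∑ m ∈ Icc 1 n, f m :=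
  prod_fin_succ (M := Multiplicative M) n f

/-! ### Cycle counts, powers, conjugacy classes and signs of permutations -/

section Count

variable {α : Type*} [Fintype α] [DecidableEq α]

/-- The number of cycles of length `m` of a permutation, fixed points being cycles of length 1. -/
def cycleCount (σ : Perm α) (m : ℕ) : ℕ := σ.partition.parts.count m

/-- Both numbers divide exactly those `n` for which `σ ^ n` fixes `x`. -/
theorem minimalPeriod_eq_card_support_cycleOf (σ : Perm α) {x : α} (hx : x ∈ σ.support) :
    Function.minimalPeriod σ x = #(σ.cycleOf x).support := by
  have hmem : x ∈ (σ.cycleOf x).support := by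
    rw [mem_support_cycleOf_iff]
    exact ⟨SameCycle.refl _ _, hx⟩
  have key (n : ℕ) : Function.minimalPeriod σ x ∣ n ↔ #(σ.cycleOf x).support ∣ n := by
    rw [← (isCycleOn_support_cycleOf σ x).pow_apply_eq hmem,
      ← Function.isPeriodicPt_iff_minimalPeriod_dvd, Function.IsPeriodicPt, Function.IsFixedPt,
      Equiv.Perm.iterate_eq_pow]
  exact Nat.dvd_antisymm ((key _).2 dvd_rfl) ((key _).1 dvd_rfl)

omit [DecidableEq α] in
theorem minimalPeriod_perm_pos (σ : Perm α) (x : α) : 0 < Function.minimalPeriod σ x := by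
  apply Function.IsPeriodicPt.minimalPeriod_pos (orderOf_pos σ)
  simp [Function.IsPeriodicPt, Function.IsFixedPt, Equiv.Perm.iterate_eq_pow, pow_orderOf_eq_one]

theorem cycleCount_one (σ : Perm α) : cycleCount σ 1 = Fintype.card α - #σ.support := by
  rw [cycleCount, parts_partition, Multiset.count_add, Multiset.count_replicate_self,
    Multiset.count_eq_zero_of_notMem, zero_add]
  intro h
  exact absurd (two_le_of_mem_cycleType h) (by norm_num)

theorem cycleCount_of_ne_one (σ : Perm α) {m : ℕ} (hm : m ≠ 1) :
    cycleCount σ m = σ.cycleType.count m := by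
  rw [cycleCount, parts_partition, Multiset.count_add, Multiset.count_replicate, if_neg hm.symm,
    add_zero]

/-- The points lying on cycles of length `m`. -/
theorem card_minimalPeriod_eq (σ : Perm α) {m : ℕ} (hm : 0 < m) :
    #{x | Function.minimalPeriod σ x = m} = m * cycleCount σ m := by
  rcases eq_or_ne m 1 with rfl | hm1
  · rw [cycleCount_one, one_mul, ← Finset.card_compl]
    congr 1
    ext x
    simp [Function.minimalPeriod_eq_one_iff_isFixedPt, Function.IsFixedPt]
  · rw [cycleCount_of_ne_one σ hm1]
    have hset : ({x | Function.minimalPeriod σ x = m} : Finset α) =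
        (σ.cycleFactorsFinset.filter fun c => #c.support = m).biUnion fun c => c.support := by
      ext x
      simp only [mem_filter, mem_univ, true_and, mem_biUnion]
      constructor
      · intro h
        have hx : x ∈ σ.support := by
          by_contra hx
          rw [notMem_support] at hx
          exact hm1 (h.symm.trans (Function.minimalPeriod_eq_one_iff_isFixedPt.2 hx))
        refine ⟨σ.cycleOf x, ⟨cycleOf_mem_cycleFactorsFinset_iff.2 hx, ?_⟩, ?_⟩
        · rw [← minimalPeriod_eq_card_support_cycleOf σ hx, h]
        · rw [mem_support_cycleOf_iff]
          exact ⟨SameCycle.refl _ _, hx⟩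
      · rintro ⟨c, ⟨hc, hcm⟩, hx⟩
        rw [minimalPeriod_eq_card_support_cycleOf σ (mem_cycleFactorsFinset_support_le hc hx),
          ← (eq_cycleOf_of_mem_cycleFactorsFinset_iff σ c hc x).2 hx, hcm]
    rw [hset, card_biUnion, sum_const_nat (m := m)]
    · rw [mul_comm, cycleType_def, Multiset.count_map]
      simp only [Function.comp, eq_comm (a := m)]
      rfl
    · intro c hc
      exact (mem_filter.1 hc).2
    · intro c hc d hd hcd
      exact disjoint_iff_disjoint_support.1 (cycleFactorsFinset_pairwise_disjoint σ
        (mem_filter.1 hc).1 (mem_filter.1 hd).1 hcd)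

theorem mem_parts_le (σ : Perm α) {m : ℕ} (h : m ∈ σ.partition.parts) :
    m ∈ Icc 1 (Fintype.card α) :=
  mem_Icc.2 ⟨σ.partition.parts_pos h, Nat.Partition.le_of_mem_parts h⟩

theorem sum_mul_cycleCount (σ : Perm α) :
    ∑ m ∈ Icc 1 (Fintype.card α), m * cycleCount σ m = Fintype.card α := by
  conv_rhs => rw [← σ.partition.parts_sum, Finset.sum_multiset_count]
  symm
  refine (Finset.sum_subset (fun m hm => mem_parts_le σ (Multiset.mem_toFinset.1 hm)) ?_).trans ?_
  · intro m _ hm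
    rw [Multiset.mem_toFinset] at hm
    simp [Multiset.count_eq_zero_of_notMem hm]
  · simp [cycleCount, mul_comm]

/-- Points are easier to count than cycles: a point of period `m` under `τ` has period `m / gcd(m,
k)` under `τ ^ k`. Dividing the count of points by `l` turns `m` into `gcd(m, k)`. -/
theorem cycleCount_pow (τ : Perm α) {k : ℕ} (hk : 0 < k) {l : ℕ} (hl : 0 < l) :
    cycleCount (τ ^ k) l =
      ∑ m ∈ (Icc 1 (Fintype.card α)).filter (fun m => m / m.gcd k = l),
        m.gcd k * cycleCount τ m := by
  apply Nat.eq_of_mul_eq_mul_left hl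
  rw [← card_minimalPeriod_eq _ hl, Finset.mul_sum]
  have hper (x : α) : Function.minimalPeriod (τ ^ k : Perm α) x =
      Function.minimalPeriod τ x / (Function.minimalPeriod τ x).gcd k := by
    rw [← Function.minimalPeriod_iterate_eq_div_gcd hk.ne', Equiv.Perm.iterate_eq_pow]
  have hle (x : α) : Function.minimalPeriod τ x ≤ Fintype.card α := by
    by_contra! h
    have h1 := card_minimalPeriod_eq τ (minimalPeriod_perm_pos τ x)
    have h2 : 0 < #{y | Function.minimalPeriod τ y = Function.minimalPeriod τ x} :=
      card_pos.2 ⟨x, by simp⟩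
    have h3 : 0 < cycleCount τ (Function.minimalPeriod τ x) := by
      rw [h1] at h2
      exact Nat.pos_of_mul_pos_left h2
    have h4 := mem_parts_le τ (Multiset.count_pos.1 h3)
    exact absurd (mem_Icc.1 h4).2 (by omega)
  rw [Finset.card_eq_sum_card_fiberwise (f := fun x => Function.minimalPeriod τ x)
    (t := (Icc 1 (Fintype.card α)).filter (fun m => m / m.gcd k = l))]
  · refine Finset.sum_congr rfl fun m hm => ?_
    obtain ⟨hm, hml⟩ := mem_filter.1 hm
    have hm0 : 0 < m := (mem_Icc.1 hm).1
    have : l * m.gcd k = m := by rw [← hml, Nat.div_mul_cancel (Nat.gcd_dvd_left m k)]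
    rw [← mul_assoc, this, ← card_minimalPeriod_eq τ hm0]
    congr 1
    ext x
    simp only [mem_filter, mem_univ, true_and, hper]
    constructor
    · exact fun h => h.2
    · rintro rfl
      exact ⟨hml, rfl⟩
  · intro x hx
    simp only [coe_filter, mem_univ, true_and, Set.mem_ofPred_eq, hper, mem_Icc] at hx ⊢
    exact ⟨⟨minimalPeriod_perm_pos τ x, hle x⟩, hx⟩

/-- `cycleType` omits fixed points; their factorial becomes the factor `m = 1` of a uniform product.
-/
theorem cycleType_centralizer_eq (σ : Perm α) :
    (Fintype.card α - σ.cycleType.sum).factorial * σ.cycleType.prod *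
      (∏ m ∈ σ.cycleType.toFinset, (σ.cycleType.count m).factorial) =
    ∏ m ∈ Icc 1 (Fintype.card α), m ^ cycleCount σ m * (cycleCount σ m).factorial := by
  have hprod : σ.cycleType.prod = ∏ m ∈ Icc 1 (Fintype.card α), m ^ cycleCount σ m := by
    have h1 : σ.cycleType.prod = σ.partition.parts.prod := by
      rw [parts_partition, Multiset.prod_add, Multiset.prod_replicate, one_pow, mul_one]
    rw [h1, Finset.prod_multiset_count]
    refine Finset.prod_subset (fun m hm => mem_parts_le σ (Multiset.mem_toFinset.1 hm)) ?_
    intro m _ hm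
    rw [Multiset.mem_toFinset] at hm
    simp [Multiset.count_eq_zero_of_notMem hm]
  have h1 : 1 ∉ σ.cycleType.toFinset := fun h =>
    absurd (two_le_of_mem_cycleType (Multiset.mem_toFinset.1 h)) (by norm_num)
  have hfact : (Fintype.card α - σ.cycleType.sum).factorial *
      (∏ m ∈ σ.cycleType.toFinset, (σ.cycleType.count m).factorial) =
      ∏ m ∈ Icc 1 (Fintype.card α), (cycleCount σ m).factorial := by
    have h2 : ∏ m ∈ σ.cycleType.toFinset, (σ.cycleType.count m).factorial =
        ∏ m ∈ σ.cycleType.toFinset, (cycleCount σ m).factorial :=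
      Finset.prod_congr rfl fun m hm => by
        rw [cycleCount_of_ne_one σ (fun h => h1 (h ▸ hm))]
    rw [sum_cycleType, ← cycleCount_one, h2,
      ← Finset.prod_insert (f := fun m => (cycleCount σ m).factorial) h1]
    have hz (m : ℕ) (hm : m ∉ insert 1 σ.cycleType.toFinset) : m ∉ σ.partition.parts := by
      rw [mem_insert, not_or, Multiset.mem_toFinset] at hm
      rw [parts_partition, Multiset.mem_add, not_or]
      exact ⟨hm.2, fun h => hm.1 (Multiset.eq_of_mem_replicate h)⟩
    -- If `α` is empty, `1` is not in `Icc 1 0`, so both index sets are compared with their union.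
    refine (Finset.prod_subset (s₂ := insert 1 σ.cycleType.toFinset ∪ Icc 1 (Fintype.card α))
      Finset.subset_union_left ?_).trans (Finset.prod_subset Finset.subset_union_right ?_).symm
    · intro m _ hm
      simp [cycleCount, Multiset.count_eq_zero_of_notMem (hz m hm)]
    · intro m _ hm
      have : m ∉ σ.partition.parts := fun h => hm (mem_parts_le σ h)
      simp [cycleCount, Multiset.count_eq_zero_of_notMem this]
  rw [Finset.prod_mul_distrib, ← hprod, ← hfact]
  ring

theorem isConj_iff_cycleCount_eq (σ τ : Perm α) :
    IsConj σ τ ↔ ∀ m ∈ Icc 1 (Fintype.card α), cycleCount σ m = cycleCount τ m := by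
  rw [partition_eq_of_isConj, Nat.Partition.ext_iff, Multiset.ext]
  refine ⟨fun h m _ => h m, fun h m => ?_⟩
  by_cases hm : m ∈ Icc 1 (Fintype.card α)
  · exact h m hm
  · rw [Multiset.count_eq_zero_of_notMem fun h => hm (mem_parts_le _ h),
      Multiset.count_eq_zero_of_notMem fun h => hm (mem_parts_le _ h)]

theorem card_isConj_mul_prod (σ : Perm α) :
    Nat.card {τ : Perm α | IsConj σ τ} *
      ∏ m ∈ Icc 1 (Fintype.card α), m ^ cycleCount σ m * (cycleCount σ m).factorial =
      (Fintype.card α).factorial := by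
  rw [← cycleType_centralizer_eq, card_isConj_mul_eq]

/-- Only the cycles of length at least 2 need to be prescribed; by `hf` the number of points left
over is `f 1`. -/
theorem exists_cycleCount_eq (f : ℕ → ℕ)
    (hf : ∑ m ∈ Icc 1 (Fintype.card α), m * f m = Fintype.card α) :
    ∃ τ : Perm α, ∀ m ∈ Icc 1 (Fintype.card α), cycleCount τ m = f m := by
  set N := Fintype.card α with hN
  let P : Multiset ℕ := ∑ m ∈ Icc 2 N, Multiset.replicate (f m) m
  have hcount (m : ℕ) (hm : m ∈ Icc 2 N) : P.count m = f m := by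
    simp only [P, Multiset.count_sum', Multiset.count_replicate]
    rw [Finset.sum_ite_eq' , if_pos hm]
  have hsum : P.sum = ∑ m ∈ Icc 2 N, m * f m := by
    simp [P, mul_comm, Multiset.sum_sum]
  -- For `N = 0` the value `f 1` is unconstrained.
  have htotal : 1 ≤ N → f 1 + P.sum = N := by
    intro h
    conv_rhs => rw [← hf, ← Finset.insert_Icc_add_one_left_eq_Icc h, Finset.sum_insert (by simp)]
    rw [hsum, one_mul, one_add_one_eq_two]
  have hP : P.sum ≤ N ∧ ∀ a ∈ P, 2 ≤ a := by
    constructor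
    · rw [hsum]
      conv_rhs => rw [← hf]
      exact Finset.sum_le_sum_of_subset (Finset.Icc_subset_Icc_left (by norm_num))
    · intro a ha
      simp only [P, Multiset.mem_sum] at ha
      obtain ⟨m, hm, ham⟩ := ha
      rw [Multiset.eq_of_mem_replicate ham]
      exact (mem_Icc.1 hm).1
  obtain ⟨τ, hτ⟩ := (exists_with_cycleType_iff α).2 hP
  refine ⟨τ, fun m hm => ?_⟩
  rcases eq_or_ne m 1 with rfl | hm1
  · have := htotal (mem_Icc.1 hm).2
    rw [cycleCount_one, ← sum_cycleType, hτ]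
    omega
  · rw [cycleCount_of_ne_one τ hm1, hτ, hcount]
    rw [mem_Icc] at hm ⊢
    omega

/-- An `m`-cycle has sign `(-1)^(m+1)`, which is `1` for fixed points. -/
theorem sign_eq_prod_cycleCount (σ : Perm α) :
    ((sign σ : ℤ) : ℚ) =
      ∏ m ∈ Icc 1 (Fintype.card α), ((-1 : ℚ) ^ (m + 1)) ^ cycleCount σ m := by
  have h1 : (σ.partition.parts.map fun m => (-1 : ℚ) ^ (m + 1)).prod =
      (σ.cycleType.map fun m => (-1 : ℚ) ^ (m + 1)).prod := by
    rw [parts_partition, Multiset.map_add, Multiset.prod_add, Multiset.map_replicate,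
      Multiset.prod_replicate]
    simp
  have h2 : ((sign σ : ℤ) : ℚ) = (σ.cycleType.map fun m => (-1 : ℚ) ^ (m + 1)).prod := by
    rw [sign_of_cycleType']
    induction σ.cycleType using Multiset.induction with
    | empty => simp
    | cons a s ih =>
      rw [Multiset.map_cons, Multiset.prod_cons, Multiset.map_cons, Multiset.prod_cons, ← ih]
      push_cast
      ring
  rw [h2, ← h1, Finset.prod_multiset_map_count]
  refine Finset.prod_subset (fun m hm => mem_parts_le σ (Multiset.mem_toFinset.1 hm)) ?_
  intro m _ hm
  rw [Multiset.mem_toFinset] at hm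
  simp [Multiset.count_eq_zero_of_notMem hm]

end Count

/-! ### Coefficients of the exponential of a sum of monomials -/

section Exponential

variable {σ : Type*}

/-- Weights add under multiplication, so coefficients of weight at most `N` in a power involve only
such coefficients of the base. This permits truncating the infinite exponent to a finite sum. -/
theorem coeff_pow_congr (w : (σ →₀ ℕ) →+ ℕ) {N : ℕ} {F F' : MvPowerSeries σ ℚ}
    (h : ∀ e, w e ≤ N → MvPowerSeries.coeff e F = MvPowerSeries.coeff e F') (r : ℕ) :
    ∀ e, w e ≤ N → MvPowerSeries.coeff e (F ^ r) = MvPowerSeries.coeff e (F' ^ r) := by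
  classical
  induction r with
  | zero => simp
  | succ r ih =>
    intro e he
    rw [pow_succ, pow_succ, MvPowerSeries.coeff_mul, MvPowerSeries.coeff_mul]
    refine Finset.sum_congr rfl fun p hp => ?_
    have hw : w p.1 + w p.2 = w e := by rw [← map_add, mem_antidiagonal.1 hp]
    rw [ih p.1 (by omega), h p.2 (by omega)]

/-- The multinomial theorem, with `r!` cancelled. -/
theorem coeff_sum_monomial_pow [DecidableEq σ] {ι : Type*} [Fintype ι] [DecidableEq ι]
    (v : ι → σ →₀ ℕ)
    (a : ι → ℚ) (r : ℕ) (d : σ →₀ ℕ) :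
    ((1 : ℚ) / r.factorial) *
        MvPowerSeries.coeff d ((∑ i, MvPowerSeries.monomial (v i) (a i)) ^ r) =
      ∑ j ∈ (piAntidiag univ r).filter (fun j : ι → ℕ => ∑ i, j i • v i = d),
        ∏ i, a i ^ j i / (j i).factorial := by
  rw [Finset.sum_pow_eq_sum_piAntidiag, map_sum, Finset.mul_sum, Finset.sum_filter]
  refine Finset.sum_congr rfl fun j hj => ?_
  have hr : ∑ i, j i = r := (mem_piAntidiag.1 hj).1
  have hspec : (∏ i, ((j i).factorial : ℚ)) * (Nat.multinomial univ j : ℚ) = r.factorial := by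
    rw [← hr]
    exact_mod_cast Nat.multinomial_spec univ j
  have hr0 : (r.factorial : ℚ) ≠ 0 := by positivity
  have hj0 : (∏ i, ((j i).factorial : ℚ)) ≠ 0 :=
    Finset.prod_ne_zero_iff.2 fun i _ => by positivity
  rw [← nsmul_eq_mul, map_nsmul, nsmul_eq_mul]
  simp_rw [MvPowerSeries.monomial_pow]
  rw [MvPowerSeries.prod_monomial, MvPowerSeries.coeff_monomial, Finset.prod_div_distrib]
  by_cases h : ∑ i, j i • v i = d
  · rw [if_pos h, if_pos h.symm]
    field_simp
    rw [← hspec]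
    ring
  · rw [if_neg h, if_neg (Ne.symm h), mul_zero, mul_zero]

/-- Each `v i` has positive weight, so a contributing `j` has total at most `n`. Hence only the
powers `F ^ r` with `r ≤ n` matter, and every such `j` lies in the finite box. -/
theorem coeff_exp_sum_monomial [DecidableEq σ] {n : ℕ} (v : Fin n → σ →₀ ℕ) (a : Fin n → ℚ)
    (w : (σ →₀ ℕ) →+ ℕ) (hw : ∀ i, 0 < w (v i)) {F : MvPowerSeries σ ℚ}
    (hF : ∀ e, w e ≤ n → MvPowerSeries.coeff e F =
      MvPowerSeries.coeff e (∑ i, MvPowerSeries.monomial (v i) (a i)))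
    {d : σ →₀ ℕ} (hd : w d ≤ n) :
    MvPowerSeries.coeff d ((PowerSeries.exp ℚ).subst F) =
      ∑ j ∈ (Fintype.piFinset fun _ : Fin n => range (n + 1)).filter
        (fun j : Fin n → ℕ => ∑ i, j i • v i = d), ∏ i, a i ^ j i / (j i).factorial := by
  have hF0 : MvPowerSeries.constantCoeff F = 0 := by
    rw [← MvPowerSeries.coeff_zero_eq_constantCoeff_apply, hF 0 (by simp), map_sum]
    refine Finset.sum_eq_zero fun i _ => ?_
    rw [MvPowerSeries.coeff_monomial, if_neg]
    intro h
    have := hw i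
    rw [← h] at this
    simp at this
  have hle (j : Fin n → ℕ) (hj : ∑ i, j i • v i = d) : ∑ i, j i ≤ n := by
    refine le_trans ?_ hd
    rw [← hj, map_sum]
    refine Finset.sum_le_sum fun i _ => ?_
    rw [map_nsmul, smul_eq_mul]
    exact Nat.le_mul_of_pos_right _ (hw i)
  rw [PowerSeries.coeff_subst (PowerSeries.HasSubst.of_constantCoeff_zero hF0)]
  have hterm (r : ℕ) : PowerSeries.coeff r (PowerSeries.exp ℚ) • MvPowerSeries.coeff d (F ^ r) =
      ∑ j ∈ (piAntidiag univ r).filter (fun j : Fin n → ℕ => ∑ i, j i • v i = d),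
        ∏ i, a i ^ j i / (j i).factorial := by
    rw [PowerSeries.coeff_exp, coeff_pow_congr w hF r d hd, ← coeff_sum_monomial_pow]
    simp
  simp_rw [hterm]
  rw [finsum_eq_sum_of_support_subset (s := range (n + 1))]
  · rw [← Finset.sum_fiberwise_of_maps_to (t := range (n + 1)) (g := fun j : Fin n → ℕ => ∑ i, j i)]
    · refine Finset.sum_congr rfl fun r hr => Finset.sum_congr ?_ fun _ _ => rfl
      ext j
      simp only [mem_filter, mem_piAntidiag, Fintype.mem_piFinset, mem_range, mem_univ,
        implies_true, and_true]
      constructor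
      · rintro ⟨h1, h2⟩
        refine ⟨⟨fun i => ?_, h2⟩, h1⟩
        have := Finset.single_le_sum (f := j) (fun _ _ => Nat.zero_le _) (mem_univ i)
        have := hle j h2
        omega
      · rintro ⟨⟨_, h2⟩, h1⟩
        exact ⟨h1, h2⟩
    · intro j hj
      have := hle j (mem_filter.1 hj).2
      rw [mem_range]
      omega
  · intro r hr
    rw [Function.mem_support] at hr
    obtain ⟨j, hj, -⟩ := Finset.exists_ne_zero_of_sum_ne_zero hr
    obtain ⟨hj1, hj2⟩ := mem_filter.1 hj
    have := hle j hj2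
    have : ∑ i, j i = r := (mem_piAntidiag.1 hj1).1
    simp only [coe_range, Set.mem_Iio]
    omega

end Exponential

/-! ### Reindexing the exponent by the cycle lengths of the root -/

/-- The length of the cycles into which the `k`th power splits a cycle of length `i + 1`. -/
def splitLength (k i : ℕ) : ℕ+ :=
  ⟨(i + 1) / (i + 1).gcd k, Nat.div_pos (Nat.gcd_le_left _ i.succ_pos)
    (Nat.gcd_pos_of_pos_left _ i.succ_pos)⟩

/-- The cycle type, as an exponent vector, of the `k`th power of a cycle of length `i + 1`. -/
noncomputable def splitExponent (k i : ℕ) : ℕ+ →₀ ℕ :=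
  Finsupp.single (splitLength k i) ((i + 1).gcd k)

theorem splitLength_mul_gcd (k i : ℕ) : (splitLength k i : ℕ) * (i + 1).gcd k = i + 1 :=
  Nat.div_mul_cancel (Nat.gcd_dvd_left _ _)

theorem gcd_mem_G {k : ℕ} (hk : 0 < k) (i : ℕ) : (i + 1).gcd k ∈ G k (splitLength k i) := by
  rw [mem_G hk, mul_comm, splitLength_mul_gcd]
  exact ⟨Nat.gcd_pos_of_pos_right _ hk, rfl⟩

/-- This is the bijection between pairs `(ℓ, g)` and lengths `m = ℓg`: membership in `G k l` says
exactly that `gcd(ℓg, k) = g`. -/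
theorem splitExponent_eq_single_iff {k : ℕ} (hk : 0 < k) {i g : ℕ} {l : ℕ+} (hg : g ∈ G k l) :
    splitExponent k i = Finsupp.single l g ↔ i + 1 = l * g := by
  obtain ⟨hg0, hgcd⟩ := (mem_G hk).1 hg
  rw [splitExponent, Finsupp.single_eq_single_iff]
  constructor
  · rintro (⟨h1, h2⟩ | ⟨_, h2⟩)
    · rw [← splitLength_mul_gcd k i, h1, h2]
    · omega
  · intro h
    have h1 : (i + 1).gcd k = g := by rw [h, mul_comm, hgcd]
    refine Or.inl ⟨PNat.eq ?_, h1⟩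
    change (i + 1) / (i + 1).gcd k = l
    rw [h1, h, Nat.mul_div_cancel _ hg0]

/-- `∑_{g ∈ G_k(ℓ)} s(ℓg) (ℓ^(g-1) / g) t_ℓ^g`. -/
noncomputable def weightedTerm (s : ℕ → ℚ) (k : ℕ) (ℓ : ℕ+) : Series :=
  ∑ g ∈ G k ℓ, (s (ℓ * g) * (((ℓ : ℕ) : ℚ) ^ (g - 1) / (g : ℚ))) •
    (MvPowerSeries.X ℓ : Series) ^ g

theorem term_eq_weightedTerm (k : ℕ) : term k = weightedTerm (fun _ => 1) k := by
  funext l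
  simp [term, weightedTerm]

theorem signedTerm_eq_weightedTerm (k : ℕ) :
    signedTerm k = weightedTerm (fun m => (-1) ^ (m + 1)) k := rfl

/-- The contribution of cycles of length `i + 1` to the exponent of the generating function. -/
noncomputable def splitCoeff (s : ℕ → ℚ) (k i : ℕ) : ℚ :=
  s (i + 1) * ((splitLength k i : ℕ) : ℚ) ^ (i + 1).gcd k / ((i : ℚ) + 1)

theorem coeff_weightedTerm (s : ℕ → ℚ) (k : ℕ) (l : ℕ+) (e : ℕ+ →₀ ℕ) :
    MvPowerSeries.coeff e (weightedTerm s k l) =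
      ∑ g ∈ G k l, if e = Finsupp.single l g then
        s (l * g) * (((l : ℕ) : ℚ) ^ (g - 1) / (g : ℚ)) else 0 := by
  rw [weightedTerm, map_sum]
  refine Finset.sum_congr rfl fun g _ => ?_
  rw [MvPowerSeries.coeff_smul, MvPowerSeries.coeff_X_pow]
  simp

/-- The weighted degree in which `t_ℓ` has degree `ℓ`. -/
noncomputable def cycleWeight : (ℕ+ →₀ ℕ) →+ ℕ := Finsupp.weight (fun l : ℕ+ => (l : ℕ))

theorem cycleWeight_single (l : ℕ+) (g : ℕ) : cycleWeight (Finsupp.single l g) = l * g := by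
  simp [cycleWeight, Finsupp.weight_single, mul_comm]

theorem coeff_formalSum_weightedTerm (s : ℕ → ℚ) {k : ℕ} (hk : 0 < k) {n : ℕ} {e : ℕ+ →₀ ℕ}
    (he : cycleWeight e ≤ n) :
    MvPowerSeries.coeff e (formalSum (weightedTerm s k)) =
      MvPowerSeries.coeff e
        (∑ i : Fin n, MvPowerSeries.monomial (splitExponent k i) (splitCoeff s k i) : Series) := by
  have hL : MvPowerSeries.coeff e (formalSum (weightedTerm s k)) =
      ∑ᶠ l : ℕ+, MvPowerSeries.coeff e (weightedTerm s k l) := rfl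
  simp_rw [hL, coeff_weightedTerm, map_sum, MvPowerSeries.coeff_monomial]
  -- A monomial `t_l^g` with `g > 0` determines `l` and `g`, so each side has a single nontrivial
  -- term or none.
  by_cases h : ∃ l : ℕ+, ∃ g ∈ G k l, e = Finsupp.single l g
  · obtain ⟨l, g, hg, rfl⟩ := h
    rw [cycleWeight_single] at he
    have hg0 := ((mem_G hk).1 hg).1
    have hlg : 0 < (l : ℕ) * g := Nat.mul_pos l.pos hg0
    rw [finsum_eq_single _ l, Finset.sum_eq_single g, if_pos rfl,
      Finset.sum_eq_single (⟨l * g - 1, by omega⟩ : Fin n), if_pos]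
    · have hi : (l : ℕ) * g - 1 + 1 = l * g := by omega
      have hsp := (splitExponent_eq_single_iff hk hg).2 hi
      rw [splitExponent, Finsupp.single_eq_single_iff] at hsp
      obtain ⟨h1, h2⟩ : splitLength k (l * g - 1) = l ∧ (l * g - 1 + 1).gcd k = g := by
        rcases hsp with h | h
        · exact h
        · omega
      have hi' : (((l : ℕ) * g - 1 : ℕ) : ℚ) + 1 = l * g := by exact_mod_cast hi
      rw [splitCoeff, h1, h2, hi, hi']
      obtain ⟨g, rfl⟩ : ∃ g', g = g' + 1 := ⟨g - 1, by omega⟩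
      have : ((l : ℕ) : ℚ) ≠ 0 := by exact_mod_cast l.ne_zero
      rw [Nat.add_sub_cancel, pow_succ]
      field_simp
    · exact ((splitExponent_eq_single_iff hk hg).2 (by simp; omega)).symm
    · intro i _ hi
      rw [if_neg]
      intro h
      apply hi
      have := (splitExponent_eq_single_iff hk hg).1 h.symm
      ext
      simp
      omega
    · simp
    · intro g' _ hne
      rw [if_neg]
      rw [Finsupp.single_eq_single_iff]
      omega
    · exact fun h => absurd hg h
    · intro l' hl'
      refine Finset.sum_eq_zero fun g' _ => if_neg ?_
      rw [Finsupp.single_eq_single_iff]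
      rintro (h | h)
      · exact hl' h.1.symm
      · omega
  · push Not at h
    rw [finsum_eq_zero_of_forall_eq_zero, Finset.sum_eq_zero]
    · exact fun i _ => if_neg (h _ _ (gcd_mem_G hk i))
    · exact fun l => Finset.sum_eq_zero fun g hg => if_neg (h l g hg)

theorem coeff_expSeries_weightedTerm (s : ℕ → ℚ) {k : ℕ} (hk : 0 < k) {n : ℕ} {d : ℕ+ →₀ ℕ}
    (hd : cycleWeight d ≤ n) :
    MvPowerSeries.coeff d (expSeries (formalSum (weightedTerm s k))) =
      ∑ j ∈ (Fintype.piFinset fun _ : Fin n => range (n + 1)).filter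
        (fun j : Fin n → ℕ => ∑ i : Fin n, j i • splitExponent k i = d),
        ∏ i : Fin n, splitCoeff s k i ^ j i / (j i).factorial := by
  refine coeff_exp_sum_monomial (fun i : Fin n => splitExponent k i) (fun i => splitCoeff s k i)
    cycleWeight (fun i => ?_) (fun e he => coeff_formalSum_weightedTerm s hk he) hd
  rw [splitExponent, cycleWeight_single, splitLength_mul_gcd]
  exact Nat.succ_pos _

/-- Averaging over the conjugacy class: every member of it has the same weighted number of
`k`th roots. -/
theorem sum_isConj_pow {H : Type*} [Group H] [Fintype H] [DecidableEq H] (χ : H → ℚ)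
    (hχ : ∀ g τ, χ (g * τ * g⁻¹) = χ τ) (k : ℕ) (σ : H) [DecidablePred (IsConj σ)] :
    ∑ τ with IsConj σ (τ ^ k), χ τ =
      (Nat.card {ρ : H | IsConj σ ρ} : ℚ) * ∑ τ with τ ^ k = σ, χ τ := by
  rw [← Finset.sum_fiberwise_of_maps_to (t := univ.filter (IsConj σ)) (g := fun τ => τ ^ k)
    (fun τ hτ => by simpa using hτ)]
  have hfib (ρ : H) (hρ : ρ ∈ univ.filter (IsConj σ)) :
      ∑ τ ∈ univ.filter (fun τ => IsConj σ (τ ^ k)) with τ ^ k = ρ, χ τ =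
        ∑ τ with τ ^ k = σ, χ τ := by
    have hconj : IsConj σ ρ := (mem_filter.1 hρ).2
    obtain ⟨g, hg⟩ := isConj_iff.1 hconj
    symm
    -- Conjugation by `g` carries the roots of `σ` to those of `ρ` and preserves `χ`.
    refine Finset.sum_equiv (MulAut.conj g).toEquiv (fun τ => ?_) (fun τ _ => ?_)
    · simp only [mem_filter, mem_univ, true_and, MulEquiv.toEquiv_eq_coe, MulEquiv.coe_toEquiv,
        ← map_pow]
      constructor
      · intro h
        have : MulAut.conj g (τ ^ k) = ρ := by rw [h, MulAut.conj_apply, hg]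
        exact ⟨this ▸ hconj, this⟩
      · rintro ⟨-, h⟩
        rw [← hg, ← MulAut.conj_apply] at h
        exact (MulAut.conj g).injective h
    · simp [MulAut.conj_apply, hχ]
  rw [Finset.sum_congr rfl hfib, Finset.sum_const, nsmul_eq_mul]
  congr 2
  rw [Nat.card_eq_fintype_card, Fintype.card_subtype]
  rfl

/-! ### Weighted counting of roots -/

section FinPerm

variable {n : ℕ}

theorem exponent_apply_eq (c : Fin n → ℕ) (f : ℕ → ℕ) (hf : ∀ i : Fin n, f (i + 1) = c i)
    (h0 : ∀ m, n < m → f m = 0) (l : ℕ+) : exponent c l = f l := by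
  rw [exponent, Finsupp.finsetSum_apply]
  simp only [Finsupp.single_apply]
  by_cases hl : (l : ℕ) ≤ n
  · have hpos := l.pos
    rw [Finset.sum_eq_single (⟨l - 1, by omega⟩ : Fin n), if_pos, ← hf]
    · congr 1
      simp
      omega
    · apply PNat.eq
      simp
      omega
    · intro i _ hi
      rw [if_neg]
      rintro rfl
      apply hi
      ext
      simp
    · simp
  · rw [h0 _ (by omega)]
    refine Finset.sum_eq_zero fun i _ => if_neg ?_
    rintro rfl
    apply hl
    simp

theorem cycleCount_eq_zero_of_lt (σ : Perm (Fin n)) {m : ℕ} (hm : n < m) :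
    cycleCount σ m = 0 := by
  rw [cycleCount, Multiset.count_eq_zero]
  intro h
  have := (mem_Icc.1 (mem_parts_le σ h)).2
  rw [Fintype.card_fin] at this
  omega

theorem exponent_cycleCount_apply (σ : Perm (Fin n)) (l : ℕ+) :
    exponent (fun i : Fin n => cycleCount σ (i + 1)) l = cycleCount σ l :=
  exponent_apply_eq _ _ (fun _ => rfl) (fun _ => cycleCount_eq_zero_of_lt σ) l

theorem sum_splitExponent_cycleCount (τ : Perm (Fin n)) {k : ℕ} (hk : 0 < k) :
    ∑ i : Fin n, cycleCount τ (i + 1) • splitExponent k i =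
      exponent (fun i : Fin n => cycleCount (τ ^ k) (i + 1)) := by
  ext l
  rw [exponent_cycleCount_apply, cycleCount_pow τ hk l.pos, Finset.sum_filter, Fintype.card_fin,
    ← sum_fin_succ, Finsupp.finsetSum_apply]
  refine Finset.sum_congr rfl fun i _ => ?_
  have : splitLength k i = l ↔ ((i : ℕ) + 1) / ((i : ℕ) + 1).gcd k = l := by
    rw [← PNat.coe_inj]
    rfl
  rw [Finsupp.smul_apply, splitExponent, Finsupp.single_apply, smul_eq_mul, mul_ite, mul_zero]
  simp only [this, mul_comm]

/-- Conjugacy of `τ ^ k` to `σ` thus becomes the linear condition on `j` that selects terms in the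
coefficient of the exponential. -/
theorem isConj_pow_iff (σ τ : Perm (Fin n)) {k : ℕ} (hk : 0 < k) :
    IsConj σ (τ ^ k) ↔ ∑ i : Fin n, cycleCount τ (i + 1) • splitExponent k i =
      exponent (fun i : Fin n => cycleCount σ (i + 1)) := by
  rw [sum_splitExponent_cycleCount τ hk, isConj_iff_cycleCount_eq, Finsupp.ext_iff]
  simp_rw [exponent_cycleCount_apply]
  constructor
  · intro h l
    by_cases hl : (l : ℕ) ≤ n
    · exact (h l (by rw [Fintype.card_fin]; exact mem_Icc.2 ⟨l.pos, hl⟩)).symm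
    · rw [cycleCount_eq_zero_of_lt _ (by omega), cycleCount_eq_zero_of_lt _ (by omega)]
  · intro h m hm
    exact (h ⟨m, (mem_Icc.1 hm).1⟩).symm

theorem sum_succ_mul_cycleCount (σ : Perm (Fin n)) :
    ∑ i : Fin n, ((i : ℕ) + 1) * cycleCount σ (i + 1) = n := by
  have h := sum_mul_cycleCount σ
  rwa [Fintype.card_fin, ← sum_fin_succ n (fun m => m * cycleCount σ m)] at h

theorem cycleWeight_exponent (c : Fin n → ℕ) :
    cycleWeight (exponent c) = ∑ i : Fin n, ((i : ℕ) + 1) * c i := by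
  rw [exponent, map_sum]
  simp [cycleWeight_single]

theorem cycleWeight_sum_splitExponent (k : ℕ) (j : Fin n → ℕ) :
    cycleWeight (∑ i : Fin n, j i • splitExponent k i) = ∑ i : Fin n, ((i : ℕ) + 1) * j i := by
  rw [map_sum]
  refine Finset.sum_congr rfl fun i _ => ?_
  rw [map_nsmul, splitExponent, cycleWeight_single, splitLength_mul_gcd, smul_eq_mul, mul_comm]

/-- The order of the centralizer of a permutation with `j i` cycles of length `i + 1`. -/
def centralizerOrder (j : Fin n → ℕ) : ℚ :=
  ∏ i : Fin n, ((i : ℚ) + 1) ^ j i * (j i).factorial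

theorem centralizerOrder_ne_zero (j : Fin n → ℕ) : centralizerOrder j ≠ 0 :=
  Finset.prod_ne_zero_iff.2 fun i _ => by positivity

theorem card_isConj_mul_centralizerOrder (σ : Perm (Fin n)) :
    (Nat.card {τ : Perm (Fin n) | IsConj σ τ} : ℚ) *
      centralizerOrder (fun i : Fin n => cycleCount σ (i + 1)) = n.factorial := by
  have h := card_isConj_mul_prod σ
  rw [Fintype.card_fin,
    ← prod_fin_succ n (fun m => m ^ cycleCount σ m * (cycleCount σ m).factorial)] at h
  rw [← h, centralizerOrder]
  push_cast
  rfl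

/-- These permutations form one conjugacy class, nonempty by `exists_cycleCount_eq`. -/
theorem card_cycleCount_eq (j : Fin n → ℕ) (hj : ∑ i : Fin n, ((i : ℕ) + 1) * j i = n) :
    (#{τ : Perm (Fin n) | (fun i : Fin n => cycleCount τ (i + 1)) = j} : ℚ) =
      n.factorial / centralizerOrder j := by
  -- Only `m` in `Icc 1 n` matters, so the truncated `m - 1` at `m = 0` is harmless.
  let f : ℕ → ℕ := fun m => if h : m - 1 < n then j ⟨m - 1, h⟩ else 0
  have hf (i : Fin n) : f (i + 1) = j i := by simp [f]
  obtain ⟨τ₀, hτ₀⟩ := exists_cycleCount_eq (α := Fin n) f (by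
    rw [Fintype.card_fin, ← sum_fin_succ n (fun m => m * f m)]
    simpa only [hf] using hj)
  have h₀ : (fun i : Fin n => cycleCount τ₀ (i + 1)) = j := by
    funext i
    rw [hτ₀ _ (by simp), hf]
  rw [eq_div_iff (centralizerOrder_ne_zero j), ← card_isConj_mul_centralizerOrder τ₀, h₀,
    Nat.card_eq_fintype_card, Fintype.card_subtype]
  congr 3
  ext τ
  simp only [mem_filter, mem_univ, true_and, Set.mem_ofPred_eq, isConj_iff_cycleCount_eq]
  rw [← h₀, funext_iff]
  constructor
  · intro h m hm
    rw [Fintype.card_fin, mem_Icc] at hm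
    have := h ⟨m - 1, by omega⟩
    simp only [Nat.sub_add_cancel hm.1] at this
    exact this.symm
  · intro h i
    exact (h _ (by simp)).symm

/-- Apply the multiplicative map `e ↦ ∏ l^(e l)` to both sides of `h`. -/
theorem prod_splitLength_pow {k : ℕ} {j c : Fin n → ℕ}
    (h : ∑ i : Fin n, j i • splitExponent k i = exponent c) :
    ∏ i : Fin n, (((splitLength k i : ℕ) : ℚ) ^ ((i : ℕ) + 1).gcd k) ^ j i =
      ∏ i : Fin n, ((i : ℚ) + 1) ^ c i := by
  have h' := congrArg (fun e : ℕ+ →₀ ℕ => e.prod fun l a => ((l : ℕ) : ℚ) ^ a) h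
  simp only [exponent, splitExponent, Finsupp.smul_single] at h'
  rw [← Finsupp.prod_finsetSum_index (by simp) (fun _ _ _ => pow_add _ _ _),
    ← Finsupp.prod_finsetSum_index (by simp) (fun _ _ _ => pow_add _ _ _)] at h'
  simp only [Finsupp.prod_single_index, pow_zero, smul_eq_mul, Nat.succPNat_coe,
    Nat.cast_succ] at h'
  rw [← h']
  exact Finset.prod_congr rfl fun i _ => by rw [← pow_mul, mul_comm]

/-- The weighted number of `k`th roots of `σ`, each cycle of length `m` of a root having
weight `s m`, is a coefficient of the exponential generating function. -/
theorem egfCoeff_expSeries_weightedTerm (s : ℕ → ℚ) {k : ℕ} (hk : 0 < k) (σ : Perm (Fin n)) :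
    egfCoeff (fun i : Fin n => cycleCount σ (i + 1)) (expSeries (formalSum (weightedTerm s k))) =
      ∑ τ : Perm (Fin n) with τ ^ k = σ, ∏ i : Fin n, s (i + 1) ^ cycleCount τ (i + 1) := by
  classical
  set c : Fin n → ℕ := fun i => cycleCount σ (i + 1) with hc
  have hweight : cycleWeight (exponent c) = n := by
    rw [cycleWeight_exponent, hc, sum_succ_mul_cycleCount]
  have hclass := card_isConj_mul_centralizerOrder σ
  have havg := sum_isConj_pow
    (fun τ : Perm (Fin n) => ∏ i : Fin n, s (i + 1) ^ cycleCount τ (i + 1))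
    (fun g τ => by
      have : (g * τ * g⁻¹).partition = τ.partition :=
        (partition_eq_of_isConj.1 (isConj_iff.2 ⟨g, rfl⟩)).symm
      simp only [cycleCount, this]) k σ
  simp only [isConj_pow_iff σ _ hk] at havg
  rw [← hc] at havg hclass
  have hfact : (n.factorial : ℚ) ≠ 0 := by positivity
  have hcard : (Nat.card {τ : Perm (Fin n) | IsConj σ τ} : ℚ) ≠ 0 := by
    intro h
    rw [h, zero_mul] at hclass
    exact hfact hclass.symm
  -- Multiplying by the class size replaces roots of `σ` by all `τ` with `τ ^ k` conjugate to `σ`;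
  -- these are then grouped by their cycle counts `j`.
  apply mul_left_cancel₀ hcard
  rw [← havg, egfCoeff, coeff_expSeries_weightedTerm s hk hweight.le,
    ← Finset.sum_fiberwise_of_maps_to
      (t := (Fintype.piFinset fun _ : Fin n => range (n + 1)).filter
        (fun j : Fin n → ℕ => ∑ i : Fin n, j i • splitExponent k i = exponent c))
      (g := fun τ : Perm (Fin n) => fun i : Fin n => cycleCount τ (i + 1)),
    Finset.mul_sum, Finset.mul_sum]
  · refine Finset.sum_congr rfl fun j hj => ?_
    have hj' := (mem_filter.1 hj).2
    have hjn : ∑ i : Fin n, ((i : ℕ) + 1) * j i = n := by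
      rw [← cycleWeight_sum_splitExponent k, hj', hweight]
    have hset : (univ.filter fun τ : Perm (Fin n) =>
        ∑ i : Fin n, cycleCount τ (i + 1) • splitExponent k i = exponent c).filter
          (fun τ => (fun i : Fin n => cycleCount τ (i + 1)) = j) =
        univ.filter fun τ : Perm (Fin n) => (fun i : Fin n => cycleCount τ (i + 1)) = j := by
      ext τ
      simp only [mem_filter, mem_univ, true_and, and_iff_right_iff_imp]
      rintro rfl
      exact hj'
    rw [hset, Finset.sum_congr (g := fun _ => ∏ i : Fin n, s (i + 1) ^ j i) rfl, Finset.sum_const,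
      nsmul_eq_mul, card_cycleCount_eq j hjn, ← hclass]
    · have hj0 := centralizerOrder_ne_zero j
      have hterm : ∏ i : Fin n, splitCoeff s k i ^ j i / (j i).factorial =
          (∏ i : Fin n, s (i + 1) ^ j i) * (∏ i : Fin n, ((i : ℚ) + 1) ^ c i) /
            centralizerOrder j := by
        rw [← prod_splitLength_pow hj', centralizerOrder, ← Finset.prod_mul_distrib,
          ← Finset.prod_div_distrib]
        refine Finset.prod_congr rfl fun i _ => ?_
        rw [splitCoeff, div_pow, mul_pow, div_div]
      -- The factorials in `egfCoeff` complete the power product to the centralizer order of `σ`.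
      have hc' : centralizerOrder c =
          (∏ i : Fin n, ((i : ℚ) + 1) ^ c i) * ∏ i : Fin n, ((c i).factorial : ℚ) := by
        rw [centralizerOrder, Finset.prod_mul_distrib]
      rw [hterm, hc']
      ring
    · intro τ hτ
      have := (mem_filter.1 hτ).2
      refine Finset.prod_congr rfl fun i _ => ?_
      rw [← this]
  · intro τ hτ
    rw [mem_filter, Fintype.mem_piFinset]
    refine ⟨fun i => ?_, (mem_filter.1 hτ).2⟩
    -- The lengths of all cycles total `n`, so each cycle count is at most `n` and lies in the box.
    have h := Finset.single_le_sum (f := fun i : Fin n => ((i : ℕ) + 1) * cycleCount τ (i + 1))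
      (fun _ _ => Nat.zero_le _) (mem_univ i)
    rw [sum_succ_mul_cycleCount] at h
    rw [mem_range]
    have := Nat.le_mul_of_pos_left (cycleCount τ (i + 1)) (Nat.succ_pos (i : ℕ))
    simp only [Nat.succ_eq_add_one] at this
    omega

/-- For signs, the indicator of `sign τ = u` is `(1 + u * sign τ) / 2`. -/
theorem numRoots_eq_sum (k : ℕ) (σ : Perm (Fin n)) (u : ℤˣ) :
    (Nat.card {τ : Perm (Fin n) // τ ^ k = σ ∧ sign τ = u} : ℚ) =
      (1 / 2 : ℚ) * ∑ τ : Perm (Fin n) with τ ^ k = σ, (1 : ℚ) +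
        (u : ℤ) * ((1 / 2 : ℚ) * ∑ τ : Perm (Fin n) with τ ^ k = σ, ((sign τ : ℤ) : ℚ)) := by
  rw [Nat.card_eq_fintype_card, Fintype.card_subtype, ← Finset.filter_filter, Finset.card_filter,
    Nat.cast_sum, Finset.mul_sum, Finset.mul_sum, Finset.mul_sum, ← Finset.sum_add_distrib]
  refine Finset.sum_congr rfl fun τ _ => ?_
  rcases Int.units_eq_one_or (sign τ) with h | h <;> rcases Int.units_eq_one_or u with h' | h' <;>
    simp [h, h'] <;> norm_num

theorem egfCoeff_add (c : Fin n → ℕ) (F F' : Series) :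
    egfCoeff c (F + F') = egfCoeff c F + egfCoeff c F' := by
  rw [egfCoeff, map_add, mul_add, egfCoeff, egfCoeff]

theorem egfCoeff_smul (c : Fin n → ℕ) (a : ℚ) (F : Series) :
    egfCoeff c (a • F) = a * egfCoeff c F := by
  rw [egfCoeff, MvPowerSeries.coeff_smul, egfCoeff, mul_left_comm]

theorem egfCoeff_expSeries_term {k : ℕ} (hk : 0 < k) (σ : Perm (Fin n)) :
    egfCoeff (fun i : Fin n => cycleCount σ (i + 1)) (expSeries (formalSum (term k))) =
      ∑ τ : Perm (Fin n) with τ ^ k = σ, (1 : ℚ) := by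
  rw [term_eq_weightedTerm, egfCoeff_expSeries_weightedTerm _ hk]
  simp

theorem egfCoeff_expSeries_signedTerm {k : ℕ} (hk : 0 < k) (σ : Perm (Fin n)) :
    egfCoeff (fun i : Fin n => cycleCount σ (i + 1)) (expSeries (formalSum (signedTerm k))) =
      ∑ τ : Perm (Fin n) with τ ^ k = σ, ((sign τ : ℤ) : ℚ) := by
  rw [signedTerm_eq_weightedTerm, egfCoeff_expSeries_weightedTerm _ hk]
  refine Finset.sum_congr rfl fun τ _ => ?_
  rw [sign_eq_prod_cycleCount, Fintype.card_fin,
    ← prod_fin_succ n (fun m => ((-1 : ℚ) ^ (m + 1)) ^ cycleCount τ m)]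

end FinPerm

end PermRoots

theorem theorem1 (k n : ℕ) (hk : 0 < k) (hn : 0 < n) (c : Fin n → ℕ)
    (hc : n = ∑ i : Fin n, ((i : ℕ) + 1) * c i)
    (σ : Equiv.Perm (Fin n)) (hσ : PermRoots.HasCycleType σ c) :
    PermRoots.egfCoeff c (PermRoots.evenSeries k) = (PermRoots.numEvenRoots k σ : ℚ) ∧
    PermRoots.egfCoeff c (PermRoots.oddSeries k) = (PermRoots.numOddRoots k σ : ℚ) := by
  obtain rfl : (fun i : Fin n => PermRoots.cycleCount σ (i + 1)) = c := funext hσ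
  rw [PermRoots.numEvenRoots, PermRoots.numOddRoots, PermRoots.numRoots_eq_sum,
    PermRoots.numRoots_eq_sum, PermRoots.evenSeries, PermRoots.oddSeries, sub_eq_add_neg,
    ← neg_smul, PermRoots.egfCoeff_add, PermRoots.egfCoeff_add]
  simp only [PermRoots.egfCoeff_smul, PermRoots.egfCoeff_expSeries_term hk,
    PermRoots.egfCoeff_expSeries_signedTerm hk]
  constructor
  · simp
  · simp
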